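/- **Setting.** Let $S_1$ and $S_2$ be connected Riemann surfaces with (possibly empty) boundary. Let $S_2$ carry a smooth conformal metric $\rho\,|dw|^2$, $w=u+iv$, of finite area, and let $f:S_1\to S_2$ be a quasi-conformal homeomorphism (mapping interior to interior and boundary to boundary). Let $\mu$ be a Beltrami differential on $S_1$ with $\|\mu\|_\infty<1$ and constant modulus, i.e. $|\mu|$ is almost everywhere equal to a constant. Let $g(\mu)=|dz+\mu\,d\bar z|^2$ be the conformal structure on $S_1$ whose local conformal coordinates are the homeomorphic $W^{1,2}_{loc}$-solutions $\zeta$ of $\zeta_{\bar z}=\mu\,\zeta_z$. Let $[f]$ be the class of the quasi-conformal homeomorphisms $S_1\to S_2$ that are homotopic to $f$ relative to $\partial S_1$, through maps sending interior to interior; in particular they agree with $f$ on $\partial S_1$. Suppose that $\mu$ is admissible, i.e. in the domain of definition of $E_{BC}$: there is exactly one harmonic map $f(\mu,\rho):(S_1,g(\mu))\to(S_2,\rho|dw|^2)$ in $[f]$, where a harmonic map is a smooth critical point of the energy $$E_{harm}(h)=\int_{S_1}\rho(h(\zeta))\left(|h_\zeta|^2+|h_{\bar\zeta}|^2\right)d\xi\,d\eta,\qquad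 \zeta=\xi+i\eta \text{ a local conformal coordinate of } g(\mu).$$ Put $E_{BC}(\mu)=E_{harm}(f(\mu,\rho))$. **Lemma 3.1.** Under these hypotheses, $$E_{BC}(\mu)\ \ge\ \int_{S_2}\rho(w)\,du\,dv .$$ Equality holds if and only if $(S_1,g(\mu))$ is conformally equivalent to $(S_2,\rho|dw|^2)$ by a map in $[f]$, that is, if and only if some map in $[f]$ is conformal from $(S_1,g(\mu))$ to $(S_2,\rho|dw|^2)$. In case of equality the harmonic map $f(\mu,\rho)$ is conformal. -/

import Mathlib

open Set MeasureTheory Complex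
open scoped Manifold ContDiff ENNReal ComplexConjugate

noncomputable section

/-! ### Wirtinger derivatives, classical and weak -/

/-- `∂u/∂z = (u_x - i u_y) / 2`. -/
def wirtingerZ (u : ℂ → ℂ) (z : ℂ) : ℂ :=
  (fderiv ℝ u z 1 - I * fderiv ℝ u z I) / 2

/-- `∂u/∂z̄ = (u_x + i u_y) / 2`. -/
def wirtingerZbar (u : ℂ → ℂ) (z : ℂ) : ℂ :=
  (fderiv ℝ u z 1 + I * fderiv ℝ u z I) / 2

/-- `p` and `q` are locally square integrable weak derivatives `u_z`, `u_z̄` of `u` on the open set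
`U`; test functions are smooth and compactly supported in `U`. -/
structure HasWeakWirtinger (u : ℂ → ℂ) (U : Set ℂ) (p q : ℂ → ℂ) : Prop where
  memLp : ∀ K : Set ℂ, IsCompact K → K ⊆ U →
    MemLp p 2 (volume.restrict K) ∧ MemLp q 2 (volume.restrict K)
  weak : ∀ φ : ℂ → ℂ, ContDiff ℝ ∞ φ → HasCompactSupport φ → tsupport φ ⊆ U →
    (∫ z in U, u z * wirtingerZ φ z = - ∫ z in U, p z * φ z) ∧
    (∫ z in U, u z * wirtingerZbar φ z = - ∫ z in U, q z * φ z)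

/-! ### Conformal metrics and integration over a surface -/

/-- A smooth conformal metric `ρ |dw|²` on a Riemann surface: in each chart a smooth positive
function `ρ` of the coordinate, such that `ρ |dw|²` does not depend on the chart. -/
structure ConformalMetric (S : Type*) [TopologicalSpace S] [ChartedSpace ℂ S] where
  dens : OpenPartialHomeomorph S ℂ → ℂ → ℝ
  smooth : ∀ e ∈ atlas ℂ S, ContDiffOn ℝ ∞ (dens e) e.target
  pos : ∀ e ∈ atlas ℂ S, ∀ z ∈ e.target, 0 < dens e z
  compat : ∀ e ∈ atlas ℂ S, ∀ e' ∈ atlas ℂ S, ∀ z ∈ (e.symm.trans e').source,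
    dens e z = dens e' (e' (e.symm z)) * ‖deriv (e' ∘ e.symm) z‖ ^ 2

/-- The integral over a surface of the 2-form (density) that reads `D c z dx dy` in the coordinate
`z = x + iy` of each chart `c` of the atlas `𝒜`: the supremum of the sums
`∑ ∫_{c_i(A_i)} D c_i dx dy` over the finite families of disjoint Borel sets `A_i`,
each of them contained in the domain of a chart `c_i`. -/
def surfaceIntegral {S : Type*} [TopologicalSpace S] (𝒜 : Set (OpenPartialHomeomorph S ℂ))
    (D : OpenPartialHomeomorph S ℂ → ℂ → ℝ≥0∞) : ℝ≥0∞ :=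
  ⨆ (n : ℕ) (c : Fin n → OpenPartialHomeomorph S ℂ) (A : Fin n → Set S)
    (_ : ∀ i, c i ∈ 𝒜 ∧ A i ⊆ (c i).source ∧ MeasurableSet (c i '' A i))
    (_ : Pairwise fun i j => Disjoint (A i) (A j)),
    ∑ i, ∫⁻ z in c i '' A i, D (c i) z

/-- The area `∫_S ρ(w) du dv`. -/
def ConformalMetric.area {S : Type*} [TopologicalSpace S] [ChartedSpace ℂ S]
    (ρ : ConformalMetric S) : ℝ≥0∞ :=
  surfaceIntegral (atlas ℂ S) fun e z => ENNReal.ofReal (ρ.dens e z)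

/-! ### Beltrami differentials and the conformal structures they induce -/

/-- A Beltrami differential `μ dz̄/dz` on a Riemann surface with `‖μ‖_∞ < 1`: in each chart a
measurable complex function, such that `μ dz̄/dz` does not depend on the chart. -/
structure BeltramiDifferential (S : Type*) [TopologicalSpace S] [ChartedSpace ℂ S] where
  coeff : OpenPartialHomeomorph S ℂ → ℂ → ℂ
  aemeasurable : ∀ e ∈ atlas ℂ S, AEMeasurable (coeff e) (volume.restrict e.target)
  compat : ∀ e ∈ atlas ℂ S, ∀ e' ∈ atlas ℂ S,
    ∀ᵐ z ∂volume.restrict (e.symm.trans e').source,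
      coeff e z = coeff e' (e' (e.symm z)) *
        (conj (deriv (e' ∘ e.symm) z) / deriv (e' ∘ e.symm) z)
  bound : ∃ k : ℝ, k < 1 ∧ ∀ e ∈ atlas ℂ S, ∀ᵐ z ∂volume.restrict e.target, ‖coeff e z‖ ≤ k

/-- `|μ|` is constant (almost everywhere) on the surface. -/
def BeltramiDifferential.ConstantModulus {S : Type*} [TopologicalSpace S] [ChartedSpace ℂ S]
    (μ : BeltramiDifferential S) : Prop :=
  ∃ k : ℝ, ∀ e ∈ atlas ℂ S, ∀ᵐ z ∂volume.restrict e.target, ‖μ.coeff e z‖ = k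

/-- The conformal structure `g(μ) = |dz + μ dz̄|²`, given by an atlas of conformal coordinates:
local coordinates `ζ` with holomorphic transitions which are homeomorphic `W^{1,2}_loc` solutions
of the Beltrami equation `ζ_z̄ = μ ζ_z`, that is, for which `dζ` is a multiple of `dz + μ dz̄`. -/
structure InducedStructure {S : Type*} [TopologicalSpace S] [ChartedSpace ℂ S]
    (μ : BeltramiDifferential S) where
  charts : Set (OpenPartialHomeomorph S ℂ)
  cover : ∀ x : S, ∃ c ∈ charts, x ∈ c.source
  holomorphic : ∀ c ∈ charts, ∀ c' ∈ charts,
    DifferentiableOn ℂ (c' ∘ c.symm) (c.symm.trans c').source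
  beltrami : ∀ c ∈ charts, ∀ e ∈ atlas ℂ S, ∃ p q : ℂ → ℂ,
    HasWeakWirtinger (c ∘ e.symm) (e.symm.trans c).source p q ∧
    ∀ᵐ z ∂volume.restrict (e.symm.trans c).source, q z = μ.coeff e z * p z

/-! ### Maps of Riemann surfaces, read in charts

The source carries an arbitrary conformal atlas `𝒜`, the target its given one. -/

section maps

variable {S T : Type*} [TopologicalSpace S] [TopologicalSpace T] [ChartedSpace ℂ T]

/-- The open set of the coordinate plane on which `g` is read in the charts `c` and `e`. -/
def chartDom (g : S → T) (c : OpenPartialHomeomorph S ℂ) (e : OpenPartialHomeomorph T ℂ) : Set ℂ :=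
  {z | z ∈ c.target ∧ g (c.symm z) ∈ e.source}

/-- The map `g` read in the charts `c` and `e`. -/
def chartMap (g : S → T) (c : OpenPartialHomeomorph S ℂ) (e : OpenPartialHomeomorph T ℂ) : ℂ → ℂ :=
  fun z => e (g (c.symm z))

/-- The analytic condition in the definition of an (orientation preserving) quasi-conformal
homeomorphism: in charts `g` is in `W^{1,2}_loc` and `|g_z̄| ≤ k |g_z|` with a constant `k < 1`. -/
def IsQuasiconformal (𝒜 : Set (OpenPartialHomeomorph S ℂ)) (g : S → T) : Prop :=
  ∃ k : ℝ, k < 1 ∧ ∀ c ∈ 𝒜, ∀ e ∈ atlas ℂ T, ∃ p q : ℂ → ℂ,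
    HasWeakWirtinger (chartMap g c e) (chartDom g c e) p q ∧
    ∀ᵐ z ∂volume.restrict (chartDom g c e), ‖q z‖ ≤ k * ‖p z‖

/-- `g` is holomorphic in charts; a homeomorphism with this property is a conformal map. -/
def IsConformal (𝒜 : Set (OpenPartialHomeomorph S ℂ)) (g : S → T) : Prop :=
  ∀ c ∈ 𝒜, ∀ e ∈ atlas ℂ T, DifferentiableOn ℂ (chartMap g c e) (chartDom g c e)

/-- The coordinate expression `ρ(u) (|u_z|² + |u_z̄|²)` of the energy density `½ ‖dg‖²`. -/
def energyDens (r : ℂ → ℝ) (u : ℂ → ℂ) (z : ℂ) : ℝ :=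
  r (u z) * (‖wirtingerZ u z‖ ^ 2 + ‖wirtingerZbar u z‖ ^ 2)

/-- The harmonic energy `∫ ½ ‖dg‖² = ∫ ρ(g) (|g_z|² + |g_z̄|²) dx dy`. -/
def harmonicEnergy (𝒜 : Set (OpenPartialHomeomorph S ℂ)) (ρ : ConformalMetric T) (g : S → T) :
    ℝ≥0∞ :=
  surfaceIntegral 𝒜 fun c z =>
    let e := chartAt ℂ (g (c.symm z))
    ENNReal.ofReal (energyDens (ρ.dens e) (chartMap g c e) z)

/-- `g` is harmonic: it is smooth and a critical point of the harmonic energy with respect to the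
smooth variations `u + t φ` of its expressions `u` in charts, `φ` compactly supported (the energy
outside the support of `φ` does not vary). -/
def IsHarmonicMap (𝒜 : Set (OpenPartialHomeomorph S ℂ)) (ρ : ConformalMetric T) (g : S → T) :
    Prop :=
  ∀ c ∈ 𝒜, ∀ e ∈ atlas ℂ T,
    ContDiffOn ℝ ∞ (chartMap g c e) (chartDom g c e) ∧
    ∀ φ : ℂ → ℂ, ContDiff ℝ ∞ φ → HasCompactSupport φ → tsupport φ ⊆ chartDom g c e →
      HasDerivAt (fun t : ℝ => ∫ z in tsupport φ,
        energyDens (ρ.dens e) (fun x => chartMap g c e x + (t : ℂ) * φ x) z) 0 0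

end maps

/-! ### Surfaces with boundary, the class `[f]` and the functional `E_BC`

A surface with boundary is a space `Z` with an open subset `S`, its interior, which is a Riemann
surface; the boundary is the complement of `S`. -/

section surfaces

open TopologicalSpace

variable {Z₁ Z₂ : Type*} [TopologicalSpace Z₁] [TopologicalSpace Z₂]

/-- Homeomorphisms of surfaces with boundary, mapping interior to interior and boundary to
boundary. -/
structure SurfaceHomeo (S₁ : Opens Z₁) (S₂ : Opens Z₂) extends Z₁ ≃ₜ Z₂ where
  mem_iff : ∀ x, toHomeomorph x ∈ S₂ ↔ x ∈ S₁

variable {S₁ : Opens Z₁} {S₂ : Opens Z₂}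

/-- The underlying continuous map. -/
def SurfaceHomeo.toMap (g : SurfaceHomeo S₁ S₂) : C(Z₁, Z₂) :=
  ⟨g.toHomeomorph, g.toHomeomorph.continuous⟩

/-- The restriction to the interiors. -/
def SurfaceHomeo.inner (g : SurfaceHomeo S₁ S₂) (x : S₁) : S₂ :=
  ⟨g.toHomeomorph x, (g.mem_iff x).2 x.2⟩

variable [ChartedSpace ℂ S₂]

/-- The class `[f]`: the quasi-conformal maps which are homotopic to `f` relative to the boundary
(the homotopy keeps the interior in the interior). -/
def qcClass (𝒜 : Set (OpenPartialHomeomorph S₁ ℂ)) (f : SurfaceHomeo S₁ S₂) :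
    Set (SurfaceHomeo S₁ S₂) :=
  {g | IsQuasiconformal 𝒜 g.inner ∧
    ContinuousMap.HomotopicWith f.toMap g.toMap fun h =>
      (∀ x, x ∉ S₁ → h x = f.toMap x) ∧ ∀ x ∈ S₁, h x ∈ S₂}

variable [ChartedSpace ℂ S₁] {μ : BeltramiDifferential S₁}

/-- `w` is a harmonic map `(S₁, g(μ)) → (S₂, ρ|dw|²)` in the class `[f]`. -/
def IsHarmonicInClass (g : InducedStructure μ) (ρ : ConformalMetric S₂) (f w : SurfaceHomeo S₁ S₂) :
    Prop :=
  w ∈ qcClass g.charts f ∧ IsHarmonicMap g.charts ρ w.inner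

/-- `μ` is in the domain of definition of `E_BC`: there is exactly one harmonic map
`(S₁, g(μ)) → (S₂, ρ|dw|²)` in `[f]`. -/
def IsAdmissible (g : InducedStructure μ) (ρ : ConformalMetric S₂) (f : SurfaceHomeo S₁ S₂) :
    Prop :=
  ∃! w : SurfaceHomeo S₁ S₂, IsHarmonicInClass g ρ f w

/-- The harmonic map `f(μ, ρ)`. -/
def harmonicRep {g : InducedStructure μ} {ρ : ConformalMetric S₂} {f : SurfaceHomeo S₁ S₂}
    (h : IsAdmissible g ρ f) : SurfaceHomeo S₁ S₂ :=
  h.exists.choose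

/-- `E_BC(μ)`, the harmonic energy of `f(μ, ρ) : (S₁, g(μ)) → (S₂, ρ|dw|²)`. -/
def energyBC {g : InducedStructure μ} {ρ : ConformalMetric S₂} {f : SurfaceHomeo S₁ S₂}
    (h : IsAdmissible g ρ f) : ℝ≥0∞ :=
  harmonicEnergy g.charts ρ (harmonicRep h).inner

/-- `(S₁, g(μ))` and `(S₂, ρ|dw|²)` are conformally equivalent, as surfaces marked by `[f]`: some
map in `[f]` is conformal. -/
def ConformallyEquivalent (g : InducedStructure μ) (f : SurfaceHomeo S₁ S₂) : Prop :=
  ∃ φ ∈ qcClass g.charts f, IsConformal g.charts φ.inner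

end surfaces

end

/-! ### Wirtinger calculus -/

theorem fderiv_apply_eq_wirtinger (u : ℂ → ℂ) (z v : ℂ) :
    fderiv ℝ u z v = wirtingerZ u z * v + wirtingerZbar u z * conj v := by
  have hv : v = v.re • (1 : ℂ) + v.im • I := by
    apply Complex.ext <;> simp
  conv_lhs => rw [hv, map_add, map_smul, map_smul]
  simp only [wirtingerZ, wirtingerZbar, real_smul]
  have h1 : v = v.re + v.im * I := (re_add_im v).symm
  have h2 : conj v = v.re - v.im * I := by
    apply Complex.ext <;> simp
  rw [h2]
  conv_rhs => rw [h1]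
  simp only [add_re, ofReal_re, mul_re, ofReal_im, I_re, I_im, add_im, mul_im]
  ring_nf
  simp only [I_sq]
  ring_nf

theorem wirtinger_of_hasFDerivAt {u : ℂ → ℂ} {L : ℂ →L[ℝ] ℂ} {z p q : ℂ}
    (h : HasFDerivAt u L z) (hL : ∀ v, L v = p * v + q * conj v) :
    wirtingerZ u z = p ∧ wirtingerZbar u z = q := by
  rw [wirtingerZ, wirtingerZbar, h.fderiv, hL, hL]
  simp only [map_one, conj_I]
  constructor <;> ring_nf <;> simp only [I_sq] <;> ring

theorem det_fderiv_eq_wirtinger (u : ℂ → ℂ) (z : ℂ) :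
    (fderiv ℝ u z).det = ‖wirtingerZ u z‖ ^ 2 - ‖wirtingerZbar u z‖ ^ 2 := by
  have h : (fderiv ℝ u z).det =
      (fderiv ℝ u z 1).re * (fderiv ℝ u z I).im - (fderiv ℝ u z I).re * (fderiv ℝ u z 1).im := by
    rw [ContinuousLinearMap.det, ← LinearMap.det_toMatrix basisOneI, Matrix.det_fin_two]
    simp [LinearMap.toMatrix_apply]
  rw [h, wirtingerZ, wirtingerZbar, ← normSq_eq_norm_sq, ← normSq_eq_norm_sq, normSq_apply,
    normSq_apply]
  simp only [div_ofNat_re, div_ofNat_im, sub_re, sub_im, add_re, add_im, mul_re, mul_im, I_re, I_im]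
  ring

theorem wirtinger_comp_right {u h : ℂ → ℂ} {z a : ℂ} (hu : DifferentiableAt ℝ u (h z))
    (hh : HasDerivAt h a z) :
    wirtingerZ (u ∘ h) z = wirtingerZ u (h z) * a ∧
      wirtingerZbar (u ∘ h) z = wirtingerZbar u (h z) * conj a := by
  refine wirtinger_of_hasFDerivAt
    (hu.hasFDerivAt.comp z (hh.hasFDerivAt.restrictScalars ℝ)) fun v => ?_
  simp [fderiv_apply_eq_wirtinger]
  ring

theorem wirtinger_comp_left {u h : ℂ → ℂ} {z a : ℂ} (hu : DifferentiableAt ℝ u z)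
    (hh : HasDerivAt h a (u z)) :
    wirtingerZ (h ∘ u) z = a * wirtingerZ u z ∧
      wirtingerZbar (h ∘ u) z = a * wirtingerZbar u z := by
  refine wirtinger_of_hasFDerivAt
    ((hh.hasFDerivAt.restrictScalars ℝ).comp z hu.hasFDerivAt) fun v => ?_
  simp [fderiv_apply_eq_wirtinger]
  ring

theorem wirtinger_of_hasDerivAt {u : ℂ → ℂ} {z a : ℂ} (hu : HasDerivAt u a z) :
    wirtingerZ u z = a ∧ wirtingerZbar u z = 0 := by
  refine wirtinger_of_hasFDerivAt (hu.hasFDerivAt.restrictScalars ℝ) fun v => ?_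
  simp [mul_comm]

theorem wirtinger_conj_of_hasDerivAt {u : ℂ → ℂ} {z a : ℂ} (hu : HasDerivAt u a z) :
    wirtingerZ (fun x => conj (u x)) z = 0 := by
  refine (wirtinger_of_hasFDerivAt (q := conj a) (L := conjCLE.toContinuousLinearMap.comp
    ((ContinuousLinearMap.toSpanSingleton ℂ a).restrictScalars ℝ))
    ((conjCLE.toContinuousLinearMap.hasFDerivAt).comp z
      (hu.hasFDerivAt.restrictScalars ℝ)) fun v => ?_).1
  simp [mul_comm]

theorem wirtinger_add {u v : ℂ → ℂ} {z : ℂ} (hu : DifferentiableAt ℝ u z)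
    (hv : DifferentiableAt ℝ v z) :
    wirtingerZ (fun x => u x + v x) z = wirtingerZ u z + wirtingerZ v z ∧
      wirtingerZbar (fun x => u x + v x) z = wirtingerZbar u z + wirtingerZbar v z := by
  refine wirtinger_of_hasFDerivAt (hu.hasFDerivAt.add hv.hasFDerivAt) fun w => ?_
  simp only [_root_.add_apply, fderiv_apply_eq_wirtinger]
  ring

theorem wirtinger_const_mul (a : ℂ) {u : ℂ → ℂ} {z : ℂ} (hu : DifferentiableAt ℝ u z) :
    wirtingerZ (fun x => a * u x) z = a * wirtingerZ u z ∧
      wirtingerZbar (fun x => a * u x) z = a * wirtingerZbar u z := by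
  refine wirtinger_of_hasFDerivAt (hu.hasFDerivAt.const_mul a) fun w => ?_
  simp only [_root_.smul_apply, fderiv_apply_eq_wirtinger, smul_eq_mul]
  ring

theorem wirtinger_mul {u v : ℂ → ℂ} {z : ℂ} (hu : DifferentiableAt ℝ u z)
    (hv : DifferentiableAt ℝ v z) :
    wirtingerZ (fun x => u x * v x) z = u z * wirtingerZ v z + wirtingerZ u z * v z ∧
      wirtingerZbar (fun x => u x * v x) z =
        u z * wirtingerZbar v z + wirtingerZbar u z * v z := by
  refine wirtinger_of_hasFDerivAt (hu.hasFDerivAt.mul hv.hasFDerivAt) fun w => ?_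
  simp only [_root_.add_apply, _root_.smul_apply,
    fderiv_apply_eq_wirtinger, smul_eq_mul]
  ring

theorem continuousOn_wirtinger {u : ℂ → ℂ} {U : Set ℂ} (hU : IsOpen U)
    (hu : ContDiffOn ℝ ∞ u U) :
    ContinuousOn (wirtingerZ u) U ∧ ContinuousOn (wirtingerZbar u) U := by
  have h := hu.continuousOn_fderiv_of_isOpen hU (by simp)
  have h1 : ContinuousOn (fun z => fderiv ℝ u z 1) U := h.clm_apply continuousOn_const
  have hI : ContinuousOn (fun z => fderiv ℝ u z I) U := h.clm_apply continuousOn_const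
  exact ⟨(h1.sub (continuousOn_const.mul hI)).div_const 2,
    (h1.add (continuousOn_const.mul hI)).div_const 2⟩

theorem differentiableAt_of_wirtingerZbar_eq_zero {u : ℂ → ℂ} {z : ℂ}
    (hu : DifferentiableAt ℝ u z) (h : wirtingerZbar u z = 0) : DifferentiableAt ℂ u z := by
  refine (differentiableAt_complex_iff_differentiableAt_real.2 ⟨hu, ?_⟩)
  simp only [fderiv_apply_eq_wirtinger, h]
  simp [mul_comm]

/-! ### Integration by parts -/

theorem integral_fderiv_apply_eq_zero {F : ℂ → ℂ} (hF : ContDiff ℝ 1 F)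
    (hc : HasCompactSupport F) (v : ℂ) :
    Integrable (fun z => fderiv ℝ F z v) ∧ ∫ z, fderiv ℝ F z v = 0 := by
  have hi : Integrable (fun z => fderiv ℝ F z v) :=
    ((hF.continuous_fderiv (by simp)).clm_apply continuous_const).integrable_of_hasCompactSupport
      (hc.fderiv_apply ℝ v)
  refine ⟨hi, ?_⟩
  have := integral_mul_fderiv_eq_neg_fderiv_mul_of_integrable (μ := volume)
    (f := fun _ : ℂ => (1 : ℂ)) (g := F) (v := v) (by simp) (by simpa using hi)
    (by simpa using hF.continuous.integrable_of_hasCompactSupport hc)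
    (fun x _ => differentiableAt_const _) (fun x _ => hF.differentiable (by simp) x)
  simpa using this

theorem integral_wirtinger_eq_zero {F : ℂ → ℂ} (hF : ContDiff ℝ 1 F)
    (hc : HasCompactSupport F) :
    ∫ z, wirtingerZ F z = 0 ∧ ∫ z, wirtingerZbar F z = 0 := by
  obtain ⟨i1, h1⟩ := integral_fderiv_apply_eq_zero hF hc 1
  obtain ⟨i2, h2⟩ := integral_fderiv_apply_eq_zero hF hc I
  simp only [wirtingerZ, wirtingerZbar]
  constructor
  · rw [integral_div, integral_sub i1 (i2.const_mul I), integral_const_mul, h1, h2]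
    simp
  · rw [integral_div, integral_add i1 (i2.const_mul I), integral_const_mul, h1, h2]
    simp

theorem tsupport_wirtinger_subset (F : ℂ → ℂ) :
    Function.support (wirtingerZ F) ⊆ tsupport F ∧
      Function.support (wirtingerZbar F) ⊆ tsupport F := by
  have h : ∀ z, z ∉ tsupport F → fderiv ℝ F z = 0 := fun z hz =>
    Function.notMem_support.1 fun h => hz (support_fderiv_subset ℝ h)
  constructor <;> intro z hz <;> by_contra h' <;>
    simp [wirtingerZ, wirtingerZbar, h z h'] at hz

theorem contDiff_mul_of_tsupport_subset {u φ : ℂ → ℂ} {U : Set ℂ} (hU : IsOpen U)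
    {n : ℕ∞} (hu : ContDiffOn ℝ n u U) (hφ : ContDiff ℝ n φ) (hs : tsupport φ ⊆ U) :
    ContDiff ℝ n (fun z => u z * φ z) := by
  refine contDiff_iff_contDiffAt.2 fun z => ?_
  by_cases hz : z ∈ tsupport φ
  · exact (hu.contDiffAt (hU.mem_nhds (hs hz))).mul hφ.contDiffAt
  · refine contDiffAt_const (c := 0) |>.congr_of_eventuallyEq ?_
    filter_upwards [(isClosed_tsupport φ).isOpen_compl.mem_nhds hz] with x hx
    rw [image_eq_zero_of_notMem_tsupport hx, mul_zero]

theorem setIntegral_mul_wirtinger {u φ : ℂ → ℂ} {U : Set ℂ} (hU : IsOpen U)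
    (hu : ContDiffOn ℝ ∞ u U) (hφ : ContDiff ℝ ∞ φ) (hc : HasCompactSupport φ)
    (hs : tsupport φ ⊆ U) :
    (∫ z in U, u z * wirtingerZ φ z = - ∫ z in U, wirtingerZ u z * φ z) ∧
      (∫ z in U, u z * wirtingerZbar φ z = - ∫ z in U, wirtingerZbar u z * φ z) := by
  have hF := contDiff_mul_of_tsupport_subset hU (n := ⊤) hu hφ hs
  have hcF : HasCompactSupport (fun z => u z * φ z) := hc.mul_left
  obtain ⟨z1, z2⟩ := integral_wirtinger_eq_zero (hF.of_le (by simp)) hcF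
  have hd : ∀ z ∈ U, DifferentiableAt ℝ u z := fun z hz =>
    (hu.contDiffAt (hU.mem_nhds hz)).differentiableAt (by simp)
  have hdφ : ∀ z, DifferentiableAt ℝ φ z := fun z => hφ.differentiable (by simp) z
  have hcφ := continuousOn_wirtinger isOpen_univ hφ.contDiffOn
  simp only [continuousOn_univ] at hcφ
  have hcu := continuousOn_wirtinger hU hu
  have key : ∀ a b : ℂ → ℂ, ContinuousOn a U → Continuous b →
      Function.support b ⊆ tsupport φ → IntegrableOn (fun z => a z * b z) U := by
    intro a b ha hb hsb
    have hsub : Function.support (fun z => a z * b z) ⊆ tsupport φ :=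
      (Function.support_mul_subset_right a b).trans hsb
    refine Integrable.integrableOn ?_
    rw [← integrableOn_iff_integrable_of_support_subset hsub]
    exact ((ha.mono hs).mul hb.continuousOn).integrableOn_compact hc
  have split : ∀ (W : (ℂ → ℂ) → ℂ → ℂ), Function.support (W fun z => u z * φ z) ⊆ U →
      (∀ z ∈ U, W (fun z => u z * φ z) z = u z * W φ z + W u z * φ z) →
      IntegrableOn (fun z => u z * W φ z) U → IntegrableOn (fun z => W u z * φ z) U →
      ∫ z, W (fun z => u z * φ z) z = 0 →
      ∫ z in U, u z * W φ z = - ∫ z in U, W u z * φ z := by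
    intro W hsW hW i1 i2 h0
    rw [← setIntegral_eq_integral_of_forall_compl_eq_zero (s := U)
      (fun z hz => Function.notMem_support.1 fun h => hz (hsW h)),
      setIntegral_congr_fun hU.measurableSet hW, integral_add i1 i2] at h0
    exact eq_neg_of_add_eq_zero_left h0
  have hsF : tsupport (fun z => u z * φ z) ⊆ U :=
    (tsupport_mul_subset_right (f := u) (g := φ)).trans hs
  exact ⟨split wirtingerZ ((tsupport_wirtinger_subset _).1.trans hsF)
      (fun z hz => (wirtinger_mul (hd z hz) (hdφ z)).1)
      (key _ _ hu.continuousOn hcφ.1 (tsupport_wirtinger_subset φ).1)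
      (key _ _ hcu.1 hφ.continuous (subset_tsupport φ)) z1,
    split wirtingerZbar ((tsupport_wirtinger_subset _).2.trans hsF)
      (fun z hz => (wirtinger_mul (hd z hz) (hdφ z)).2)
      (key _ _ hu.continuousOn hcφ.2 (tsupport_wirtinger_subset φ).2)
      (key _ _ hcu.2 hφ.continuous (subset_tsupport φ)) z2⟩

/-- Two functions with the same integrals against all test functions agree almost everywhere. -/
theorem ae_eq_of_forall_setIntegral_mul_eq {p p' : ℂ → ℂ} {U : Set ℂ} (hU : IsOpen U)
    (hp : ∀ K : Set ℂ, IsCompact K → K ⊆ U → MemLp p 2 (volume.restrict K))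
    (hp' : ContinuousOn p' U)
    (h : ∀ φ : ℂ → ℂ, ContDiff ℝ ∞ φ → HasCompactSupport φ → tsupport φ ⊆ U →
      ∫ z in U, p z * φ z = ∫ z in U, p' z * φ z) :
    ∀ᵐ z ∂volume.restrict U, p z = p' z := by
  have ip : ∀ K : Set ℂ, IsCompact K → K ⊆ U → IntegrableOn p K := fun K hK hKU => by
    have : IsFiniteMeasure (volume.restrict K) := ⟨by simpa using hK.measure_lt_top⟩
    exact (hp K hK hKU).integrable (by norm_num)
  have ip' : ∀ K : Set ℂ, IsCompact K → K ⊆ U → IntegrableOn p' K := fun K hK hKU =>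
    (hp'.mono hKU).integrableOn_compact hK
  have hl : LocallyIntegrableOn (fun z => p z - p' z) U := by
    rw [locallyIntegrableOn_iff hU.isLocallyClosed]
    exact fun K hKU hK => (ip K hK hKU).sub (ip' K hK hKU)
  have h0 := hU.ae_eq_zero_of_integral_contDiff_smul_eq_zero hl fun g hg hgc hgs => by
    set φ : ℂ → ℂ := fun z => (g z : ℂ) with hφ
    have hsupp : Function.support φ = Function.support g := by
      ext z; simp [hφ]
    have hts : tsupport φ = tsupport g := by rw [tsupport, tsupport, hsupp]
    have hφc : HasCompactSupport φ := by rw [HasCompactSupport, hts]; exact hgc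
    have hφd : ContDiff ℝ ∞ φ := ofRealCLM.contDiff.comp hg
    have key : ∀ a : ℂ → ℂ, (∀ K : Set ℂ, IsCompact K → K ⊆ U → IntegrableOn a K) →
        IntegrableOn (fun z => a z * φ z) U := by
      intro a ha
      have hsub : Function.support (fun z => a z * φ z) ⊆ tsupport φ :=
        (Function.support_mul_subset_right a φ).trans (subset_tsupport φ)
      refine Integrable.integrableOn ?_
      rw [← integrableOn_iff_integrable_of_support_subset hsub]
      exact (ha _ hφc (hts ▸ hgs)).mul_continuousOn hφd.continuous.continuousOn hφc
    have h1 := h φ hφd hφc (hts ▸ hgs)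
    have h2 : ∫ z in U, g z • (p z - p' z) = 0 := by
      have : ∀ z, g z • (p z - p' z) = p z * φ z - p' z * φ z := fun z => by
        simp only [hφ, real_smul]; ring
      simp only [this]
      rw [integral_sub (key p ip) (key p' ip'), h1, sub_self]
    rw [← h2]
    refine (setIntegral_eq_integral_of_forall_compl_eq_zero fun z hz => ?_).symm
    have : g z = 0 := Function.notMem_support.1 fun h' => hz (hgs (subset_tsupport g h'))
    simp [this]
  rw [ae_restrict_iff' hU.measurableSet]
  filter_upwards [h0] with z hz hzU
  exact sub_eq_zero.1 (hz hzU)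

/-- Weak derivatives of a smooth function are the classical ones. -/
theorem HasWeakWirtinger.ae_eq {u p q : ℂ → ℂ} {U : Set ℂ} (hU : IsOpen U)
    (hu : ContDiffOn ℝ ∞ u U) (h : HasWeakWirtinger u U p q) :
    ∀ᵐ z ∂volume.restrict U, p z = wirtingerZ u z ∧ q z = wirtingerZbar u z := by
  have hc := continuousOn_wirtinger hU hu
  have h1 := ae_eq_of_forall_setIntegral_mul_eq hU (fun K hK hKU => (h.memLp K hK hKU).1) hc.1
    fun φ hφ hφc hs => neg_injective <| by
      rw [← (h.weak φ hφ hφc hs).1, (setIntegral_mul_wirtinger hU hu hφ hφc hs).1]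
  have h2 := ae_eq_of_forall_setIntegral_mul_eq hU (fun K hK hKU => (h.memLp K hK hKU).2) hc.2
    fun φ hφ hφc hs => neg_injective <| by
      rw [← (h.weak φ hφ hφc hs).2, (setIntegral_mul_wirtinger hU hu hφ hφc hs).2]
  filter_upwards [h1, h2] with z a b using ⟨a, b⟩

/-! ### Surface integrals -/

section surfaceIntegral

variable {S : Type*} [TopologicalSpace S]

theorem measurableSet_image_iff_borel (c : OpenPartialHomeomorph S ℂ) {A : Set S}
    (hA : A ⊆ c.source) : MeasurableSet (c '' A) ↔ MeasurableSet[borel S] A := by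
  borelize S
  constructor
  · intro h
    have h' : A = c.source ∩ c ⁻¹' (c '' A) := by
      refine Subset.antisymm (fun x hx => ⟨hA hx, mem_image_of_mem c hx⟩) ?_
      rintro x ⟨hx, y, hy, hyx⟩
      rwa [← c.injOn (hA hy) hx hyx]
    rw [h']
    obtain ⟨t, ht, e⟩ : ∃ t : Set S, MeasurableSet t ∧
        c.source ∩ c ⁻¹' (c '' A) = t := by
      have hm : Measurable (c.source.domRestrict c) :=
        (continuousOn_iff_continuous_domRestrict.1 c.continuousOn).measurable
      refine ⟨_, (c.open_source.measurableSet.subtype_image (hm h)), ?_⟩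
      ext x; simp [Set.domRestrict, and_comm]
    rwa [e]
  · intro h
    have h' : c '' A = Subtype.val '' (c.target.domRestrict c.symm ⁻¹' A) := by
      rw [c.image_eq_target_inter_inv_preimage hA]
      ext x; simp [Set.domRestrict, and_comm]
    have hm : Measurable (c.target.domRestrict c.symm) :=
      (continuousOn_iff_continuous_domRestrict.1 c.continuousOn_symm).measurable
    rw [h']
    exact c.open_target.measurableSet.subtype_image (hm h)

theorem tsum_lintegral_image_inter {ι : Type*} [Countable ι] (c : OpenPartialHomeomorph S ℂ)
    (F : ℂ → ℝ≥0∞) {A : Set S} (hA : A ⊆ c.source) (hAm : MeasurableSet[borel S] A)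
    {Q : ι → Set S} (hQ : ∀ i, MeasurableSet[borel S] (Q i))
    (hd : Pairwise (Function.onFun Disjoint Q)) :
    ∑' i, ∫⁻ z in c '' (A ∩ Q i), F z = ∫⁻ z in c '' (A ∩ ⋃ i, Q i), F z := by
  rw [inter_iUnion, image_iUnion, lintegral_iUnion]
  · intro i
    refine (measurableSet_image_iff_borel c (inter_subset_left.trans hA)).2 ?_
    borelize S
    exact hAm.inter (hQ i)
  · intro i j hij
    rw [Function.onFun, Set.disjoint_left]
    rintro _ ⟨x, hx, rfl⟩ ⟨y, hy, hyx⟩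
    have hxy := c.injOn (hA hy.1) (hA hx.1) hyx
    exact Set.disjoint_left.1 (hd hij) hx.2 (hxy ▸ hy.2)

/-- `D` transforms as a 2-form under the holomorphic changes of the charts in `𝒜`. -/
structure IsConformalDensity (𝒜 : Set (OpenPartialHomeomorph S ℂ))
    (D : OpenPartialHomeomorph S ℂ → ℂ → ℝ≥0∞) : Prop where
  holomorphic : ∀ c ∈ 𝒜, ∀ c' ∈ 𝒜, DifferentiableOn ℂ (c' ∘ c.symm) (c.symm.trans c').source
  compat : ∀ c ∈ 𝒜, ∀ c' ∈ 𝒜, ∀ z ∈ (c.symm.trans c').source,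
    D c z = D c' (c' (c.symm z)) * ENNReal.ofReal (‖deriv (c' ∘ c.symm) z‖ ^ 2)

variable {𝒜 : Set (OpenPartialHomeomorph S ℂ)} {D : OpenPartialHomeomorph S ℂ → ℂ → ℝ≥0∞}

theorem IsConformalDensity.lintegral_eq (hD : IsConformalDensity 𝒜 D)
    {c c' : OpenPartialHomeomorph S ℂ} (hc : c ∈ 𝒜) (hc' : c' ∈ 𝒜) {A : Set S}
    (hA : A ⊆ c.source) (hA' : A ⊆ c'.source) (hm : MeasurableSet (c '' A)) :
    ∫⁻ z in c '' A, D c z = ∫⁻ z in c' '' A, D c' z := by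
  have hsub : c '' A ⊆ (c.symm.trans c').source := by
    rintro _ ⟨x, hx, rfl⟩
    simp [c.map_source (hA hx), c.left_inv (hA hx), hA' hx]
  have hd : ∀ z ∈ c '' A, DifferentiableAt ℂ (c' ∘ c.symm) z := fun z hz =>
    (hD.holomorphic c hc c' hc').differentiableAt
      ((c.symm.trans c').open_source.mem_nhds (hsub hz))
  have himg : c' '' A = (c' ∘ c.symm) '' (c '' A) := by
    rw [image_image]
    exact image_congr fun x hx => by simp [c.left_inv (hA hx)]
  rw [himg, lintegral_image_eq_lintegral_abs_det_fderiv_mul volume hm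
    (fun z hz => ((hd z hz).restrictScalars ℝ).hasFDerivAt.hasFDerivWithinAt)
    ((c.symm.trans c').injOn.mono hsub)]
  refine setLIntegral_congr_fun hm fun z hz => ?_
  obtain ⟨h1, h2⟩ := wirtinger_of_hasDerivAt (hd z hz).hasDerivAt
  rw [hD.compat c hc c' hc' z (hsub hz), det_fderiv_eq_wirtinger, h1, h2]
  simp [mul_comm]

/-- A surface integral may be computed by means of any countable Borel partition that is
subordinate to the charts. -/
theorem IsConformalDensity.surfaceIntegral_eq_tsum (hD : IsConformalDensity 𝒜 D) {ι : Type*}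
    [Countable ι] {c : ι → OpenPartialHomeomorph S ℂ} (hc : ∀ i, c i ∈ 𝒜) {P : ι → Set S}
    (hP : ∀ i, P i ⊆ (c i).source) (hm : ∀ i, MeasurableSet[borel S] (P i))
    (hdisj : Pairwise (Function.onFun Disjoint P)) (hcov : ⋃ i, P i = univ) :
    surfaceIntegral 𝒜 D = ∑' i, ∫⁻ z in c i '' P i, D (c i) z := by
  have hinter : ∀ {A B : Set S}, MeasurableSet[borel S] A → MeasurableSet[borel S] B →
      MeasurableSet[borel S] (A ∩ B) := fun hA hB => by borelize S; exact hA.inter hB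
  have hmA : ∀ {e : OpenPartialHomeomorph S ℂ} {A : Set S}, A ⊆ e.source →
      MeasurableSet (e '' A) → MeasurableSet[borel S] A := fun hA h =>
    (measurableSet_image_iff_borel _ hA).1 h
  refine le_antisymm ?_ ?_
  · refine iSup_le fun n => iSup_le fun c' => iSup_le fun A => iSup_le fun h => iSup_le fun hd => ?_
    calc ∑ i, ∫⁻ z in c' i '' A i, D (c' i) z
        = ∑' i, ∑' j, ∫⁻ z in c' i '' (A i ∩ P j), D (c' i) z := by
          rw [tsum_fintype]
          refine Finset.sum_congr rfl fun i _ => ?_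
          rw [tsum_lintegral_image_inter (c' i) _ (h i).2.1 (hmA (h i).2.1 (h i).2.2) hm hdisj, hcov,
            inter_univ]
      _ = ∑' j, ∑' i, ∫⁻ z in c j '' (P j ∩ A i), D (c j) z := by
          rw [ENNReal.tsum_comm]
          refine tsum_congr fun j => tsum_congr fun i => ?_
          have hs : A i ∩ P j ⊆ (c' i).source := inter_subset_left.trans (h i).2.1
          rw [inter_comm (P j), hD.lintegral_eq (h i).1 (hc j) hs
            (inter_subset_right.trans (hP j))]
          exact (measurableSet_image_iff_borel _ hs).2
            (hinter (hmA (h i).2.1 (h i).2.2) (hm j))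
      _ = ∑' j, ∫⁻ z in c j '' (P j ∩ ⋃ i, A i), D (c j) z :=
          tsum_congr fun j => tsum_lintegral_image_inter (c j) _ (hP j) (hm j)
            (fun i => hmA (h i).2.1 (h i).2.2) hd
      _ ≤ ∑' j, ∫⁻ z in c j '' P j, D (c j) z :=
          ENNReal.tsum_le_tsum fun j => lintegral_mono_set (image_mono inter_subset_left)
  · rw [ENNReal.tsum_eq_iSup_sum]
    refine iSup_le fun s => ?_
    have hs : ∑ i ∈ s, ∫⁻ z in c i '' P i, D (c i) z = ∑ k : Fin s.card,
        ∫⁻ z in c (s.equivFin.symm k) '' P (s.equivFin.symm k), D (c (s.equivFin.symm k)) z := by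
      rw [← Finset.sum_coe_sort]
      exact (Equiv.sum_comp s.equivFin.symm fun i : s => ∫⁻ z in c i '' P i, D (c i) z).symm
    rw [hs]
    refine le_iSup_of_le s.card <| le_iSup_of_le (fun k => c (s.equivFin.symm k)) <|
      le_iSup_of_le (fun k => P (s.equivFin.symm k)) <| le_iSup_of_le
        (fun k => ⟨hc _, hP _, (measurableSet_image_iff_borel _ (hP _)).2 (hm _)⟩) <|
      le_iSup_of_le (fun i j hij => hdisj fun h' => hij ?_) le_rfl
    exact s.equivFin.symm.injective (Subtype.ext h')

/-- A second countable space with an atlas has a countable Borel partition subordinate to the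
atlas, one of whose pieces is the whole domain of a given chart. -/
theorem exists_borel_partition [SecondCountableTopology S] (hcov : ∀ x : S, ∃ c ∈ 𝒜, x ∈ c.source)
    {c₀ : OpenPartialHomeomorph S ℂ} (hc₀ : c₀ ∈ 𝒜) :
    ∃ (c : ℕ → OpenPartialHomeomorph S ℂ) (P : ℕ → Set S), (∀ i, c i ∈ 𝒜) ∧
      (∀ i, P i ⊆ (c i).source) ∧ (∀ i, MeasurableSet[borel S] (P i)) ∧
      Pairwise (Function.onFun Disjoint P) ∧ ⋃ i, P i = univ ∧ c 0 = c₀ ∧ P 0 = c₀.source := by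
  obtain ⟨T, hT, hTU⟩ := TopologicalSpace.isOpen_iUnion_countable
    (fun c : 𝒜 => c.1.source) fun c => c.1.open_source
  have hne : (insert ⟨c₀, hc₀⟩ T : Set 𝒜).Nonempty := insert_nonempty _ _
  obtain ⟨s, hs⟩ := (hT.insert ⟨c₀, hc₀⟩).exists_eq_range hne
  let c : ℕ → OpenPartialHomeomorph S ℂ := fun n => Nat.casesOn n c₀ fun k => (s k).1
  have hc : ∀ i, c i ∈ 𝒜 := fun i => by
    cases i with
    | zero => exact hc₀
    | succ k => exact (s k).2
  refine ⟨c, disjointed fun i => (c i).source, hc, fun i => disjointed_subset _ i, fun i => ?_,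
    disjoint_disjointed _, ?_, rfl, disjointed_zero _⟩
  · borelize S
    exact MeasurableSet.disjointed (fun i => (c i).open_source.measurableSet) i
  · rw [iUnion_disjointed, eq_univ_iff_forall]
    intro x
    obtain ⟨e, he, hx⟩ := hcov x
    have hx' : x ∈ ⋃ c ∈ T, c.1.source := by
      rw [hTU]; exact mem_iUnion.2 ⟨⟨e, he⟩, hx⟩
    obtain ⟨d, hd, hxd⟩ := mem_iUnion₂.1 hx'
    obtain ⟨k, hk⟩ : d ∈ range s := hs ▸ mem_insert_of_mem _ hd
    exact mem_iUnion.2 ⟨k + 1, by simpa [c, hk] using hxd⟩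

end surfaceIntegral

/-! ### Holomorphic maps are critical points of the energy -/

theorem DifferentiableOn.contDiffOn_real {u : ℂ → ℂ} {U : Set ℂ} (hU : IsOpen U)
    (hu : DifferentiableOn ℂ u U) : ContDiffOn ℝ ∞ u U :=
  (hu.contDiffOn hU).restrict_scalars ℝ

theorem ofReal_fderiv_apply {r : ℂ → ℝ} {w : ℂ} (hr : DifferentiableAt ℝ r w) (v : ℂ) :
    fderiv ℝ r w v = 2 * (wirtingerZ (fun x => (r x : ℂ)) w * v).re := by
  have h : HasFDerivAt (fun x => (r x : ℂ)) (ofRealCLM.comp (fderiv ℝ r w)) w :=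
    ofRealCLM.hasFDerivAt.comp w hr.hasFDerivAt
  have hv : v = v.re • (1 : ℂ) + v.im • I := by
    apply Complex.ext <;> simp
  have hlin : fderiv ℝ r w v = v.re * fderiv ℝ r w 1 + v.im * fderiv ℝ r w I := by
    conv_lhs => rw [hv, map_add, map_smul, map_smul]
    simp
  rw [wirtingerZ, h.fderiv, hlin]
  simp
  ring

theorem integral_firstVariation_eq_zero {r : ℂ → ℝ} {u φ : ℂ → ℂ} {T U : Set ℂ} (hT : IsOpen T)
    (hU : IsOpen U) (hr : ContDiffOn ℝ ∞ r T) (hu : DifferentiableOn ℂ u U) (hm : MapsTo u U T)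
    (hφ : ContDiff ℝ ∞ φ) (hc : HasCompactSupport φ) (hs : tsupport φ ⊆ U) :
    ∫ z in tsupport φ, (fderiv ℝ r (u z) (φ z) * ‖deriv u z‖ ^ 2 +
      r (u z) * (2 * (conj (deriv u z) * wirtingerZ φ z).re)) = 0 := by
  set R : ℂ → ℂ := fun w => (r w : ℂ) with hR
  have hRT : ContDiffOn ℝ ∞ R T := ofRealCLM.contDiff.comp_contDiffOn hr
  have hRu : ContDiffOn ℝ ∞ (R ∘ u) U := hRT.comp (hu.contDiffOn_real hU) hm
  have hcu : ContDiffOn ℝ ∞ (fun z => conj (deriv u z)) U :=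
    conjCLE.contDiff.comp_contDiffOn ((hu.deriv hU).contDiffOn_real hU)
  set s : ℂ → ℂ := fun z => conj (deriv u z) * (R ∘ u) z with hs_def
  have hsU : ContDiffOn ℝ ∞ s U := hcu.mul hRu
  have hF := contDiff_mul_of_tsupport_subset hU (n := ⊤) hsU hφ hs
  have h0 := (integral_wirtinger_eq_zero (hF.of_le (by simp)) (hc.mul_left)).1
  have hsupp : Function.support (wirtingerZ fun z => s z * φ z) ⊆ tsupport φ :=
    (tsupport_wirtinger_subset _).1.trans (tsupport_mul_subset_right (f := s) (g := φ))
  have hcont : Continuous (wirtingerZ fun z => s z * φ z) := by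
    rw [← continuousOn_univ]
    exact (continuousOn_wirtinger isOpen_univ hF.contDiffOn).1
  have hpt : ∀ z ∈ tsupport φ, fderiv ℝ r (u z) (φ z) * ‖deriv u z‖ ^ 2 +
      r (u z) * (2 * (conj (deriv u z) * wirtingerZ φ z).re) =
      2 * (wirtingerZ (fun z => s z * φ z) z).re := by
    intro z hz
    have hzU := hU.mem_nhds (hs hz)
    have hrz : DifferentiableAt ℝ r (u z) :=
      (hr.contDiffAt (hT.mem_nhds (hm (hs hz)))).differentiableAt (by simp)
    have e1 := (wirtinger_mul ((hsU.contDiffAt hzU).differentiableAt (by simp))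
      (hφ.differentiable (by simp) z)).1
    have e2 := (wirtinger_mul ((hcu.contDiffAt hzU).differentiableAt (by simp))
      ((hRu.contDiffAt hzU).differentiableAt (by simp))).1
    have e3 := (wirtinger_comp_right (u := R)
      ((hRT.contDiffAt (hT.mem_nhds (hm (hs hz)))).differentiableAt (by simp))
      (hu.differentiableAt hzU).hasDerivAt).1
    have e4 := wirtinger_conj_of_hasDerivAt ((hu.deriv hU).differentiableAt hzU).hasDerivAt
    rw [e1, e2, e3, e4, ofReal_fderiv_apply hrz, ← normSq_eq_norm_sq, normSq_apply]
    simp only [hs_def, hR, Function.comp, mul_re, mul_im, add_re, conj_re, conj_im,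
      ofReal_re, ofReal_im, zero_mul, add_zero]
    ring
  rw [setIntegral_congr_fun (isClosed_tsupport φ).measurableSet hpt, integral_const_mul,
    show (fun z => (wirtingerZ (fun z => s z * φ z) z).re) =
      fun z => reCLM (wirtingerZ (fun z => s z * φ z) z) from rfl,
    reCLM.integral_comp_comm (hcont.continuousOn.integrableOn_compact hc),
    setIntegral_eq_integral_of_forall_compl_eq_zero
      (fun z hz => Function.notMem_support.1 fun h => hz (hsupp h)), h0]
  simp

theorem hasDerivAt_integral_energyDens {r : ℂ → ℝ} {u φ : ℂ → ℂ} {T U : Set ℂ} (hT : IsOpen T)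
    (hU : IsOpen U) (hr : ContDiffOn ℝ ∞ r T) (hu : DifferentiableOn ℂ u U) (hm : MapsTo u U T)
    (hφ : ContDiff ℝ ∞ φ) (hc : HasCompactSupport φ) (hs : tsupport φ ⊆ U) :
    HasDerivAt (fun t : ℝ => ∫ z in tsupport φ,
      energyDens r (fun x => u x + (t : ℂ) * φ x) z) 0 0 := by
  set K := tsupport φ with hK
  have hKm : MeasurableSet K := (isClosed_tsupport φ).measurableSet
  have hKc : IsCompact K := hc
  set A : ℂ → ℝ := fun z => ‖deriv u z‖ ^ 2 with hA
  set B : ℂ → ℝ := fun z => 2 * (conj (deriv u z) * wirtingerZ φ z).re with hB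
  set C : ℂ → ℝ := fun z => ‖wirtingerZ φ z‖ ^ 2 + ‖wirtingerZbar φ z‖ ^ 2 with hC
  have hcφ := continuousOn_wirtinger isOpen_univ hφ.contDiffOn
  simp only [continuousOn_univ] at hcφ
  have hcd : ContinuousOn (deriv u) K := (hu.deriv hU).continuousOn.mono hs
  have hcu : ContinuousOn u K := hu.continuousOn.mono hs
  have hAc : ContinuousOn A K := hcd.norm.pow 2
  have hBc : ContinuousOn B K := continuousOn_const.mul <|
    continuous_re.comp_continuousOn ((continuous_conj.comp_continuousOn hcd).mul hcφ.1.continuousOn)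
  have hCc : Continuous C := (hcφ.1.norm.pow 2).add (hcφ.2.norm.pow 2)
  let F : ℝ → ℂ → ℝ := fun t z => r (u z + t * φ z) * (A z + t * B z + t ^ 2 * C z)
  let F' : ℝ → ℂ → ℝ := fun t z =>
    fderiv ℝ r (u z + t * φ z) (φ z) * (A z + t * B z + t ^ 2 * C z) +
      r (u z + t * φ z) * (B z + 2 * t * C z)
  have hFE : ∀ t : ℝ, ∫ z in K, energyDens r (fun x => u x + (t : ℂ) * φ x) z = ∫ z in K, F t z := by
    intro t
    refine setIntegral_congr_fun hKm fun z hz => ?_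
    have hd := hu.differentiableAt (hU.mem_nhds (hs hz))
    have hdφ : DifferentiableAt ℝ φ z := hφ.differentiable (by simp) z
    obtain ⟨a1, a2⟩ := wirtinger_add (hd.restrictScalars ℝ) (hdφ.const_mul (t : ℂ))
    obtain ⟨b1, b2⟩ := wirtinger_const_mul (t : ℂ) hdφ
    obtain ⟨c1, c2⟩ := wirtinger_of_hasDerivAt hd.hasDerivAt
    simp only [energyDens, a1, a2, b1, b2, c1, c2, F, A, B, C, ← normSq_eq_norm_sq, normSq_apply]
    simp only [mul_re, mul_im, add_re, add_im, conj_re, conj_im, ofReal_re, ofReal_im, zero_re,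
      zero_im]
    ring
  simp only [hFE]
  obtain ⟨δ, hδ, hδT⟩ := (hKc.image_of_continuousOn hcu).exists_cthickening_subset_open hT
    (image_subset_iff.2 fun z hz => hm (hs hz))
  obtain ⟨M, hM⟩ := hKc.exists_bound_of_continuousOn hφ.continuous.continuousOn
  have hM0 : 0 < |M| + 1 := by positivity
  set ε := δ / (|M| + 1) with hε
  have hε0 : 0 < ε := by positivity
  have hmem : ∀ t ∈ Icc (-ε) ε, ∀ z ∈ K, u z + t * φ z ∈ T := by
    intro t ht z hz
    refine hδT (Metric.mem_cthickening_of_dist_le _ (u z) δ _ (mem_image_of_mem u hz) ?_)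
    rw [dist_eq_norm, add_sub_cancel_left, norm_mul, norm_real, Real.norm_eq_abs]
    calc |t| * ‖φ z‖ ≤ ε * (|M| + 1) :=
          mul_le_mul (abs_le.2 ht) ((hM z hz).trans ((le_abs_self M).trans (by linarith)))
            (norm_nonneg _) hε0.le
      _ = δ := by rw [hε]; field_simp
  have hmaps : MapsTo (fun p : ℝ × ℂ => u p.2 + p.1 * φ p.2) (Icc (-ε) ε ×ˢ K) T :=
    fun p hp => hmem p.1 hp.1 p.2 hp.2
  have hsnd : MapsTo (Prod.snd : ℝ × ℂ → ℂ) (Icc (-ε) ε ×ˢ K) K := fun p hp => hp.2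
  have hcarg : ContinuousOn (fun p : ℝ × ℂ => u p.2 + p.1 * φ p.2) (Icc (-ε) ε ×ˢ K) :=
    (hcu.comp continuousOn_snd hsnd).add (by
      have := hφ.continuous
      fun_prop)
  have hcr : ContinuousOn (fun p : ℝ × ℂ => r (u p.2 + p.1 * φ p.2)) (Icc (-ε) ε ×ˢ K) :=
    hr.continuousOn.comp hcarg hmaps
  have hcr' : ContinuousOn (fun p : ℝ × ℂ => fderiv ℝ r (u p.2 + p.1 * φ p.2) (φ p.2))
      (Icc (-ε) ε ×ˢ K) :=
    ((hr.continuousOn_fderiv_of_isOpen hT (by simp)).comp hcarg hmaps).clm_apply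
      (hφ.continuous.comp continuous_snd).continuousOn
  have hA2 : ContinuousOn (fun p : ℝ × ℂ => A p.2) (Icc (-ε) ε ×ˢ K) :=
    hAc.comp continuousOn_snd hsnd
  have hB2 : ContinuousOn (fun p : ℝ × ℂ => B p.2) (Icc (-ε) ε ×ˢ K) :=
    hBc.comp continuousOn_snd hsnd
  have hC2 : ContinuousOn (fun p : ℝ × ℂ => C p.2) (Icc (-ε) ε ×ˢ K) :=
    (hCc.comp continuous_snd).continuousOn
  have hFc : ContinuousOn (fun p : ℝ × ℂ => F p.1 p.2) (Icc (-ε) ε ×ˢ K) :=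
    hcr.mul ((hA2.add (continuousOn_fst.mul hB2)).add ((continuousOn_fst.pow 2).mul hC2))
  have hFc' : ContinuousOn (fun p : ℝ × ℂ => F' p.1 p.2) (Icc (-ε) ε ×ˢ K) :=
    (hcr'.mul ((hA2.add (continuousOn_fst.mul hB2)).add ((continuousOn_fst.pow 2).mul hC2))).add
      (hcr.mul (hB2.add ((continuousOn_const.mul continuousOn_fst).mul hC2)))
  have slice : ∀ {G : ℝ → ℂ → ℝ}, ContinuousOn (fun p : ℝ × ℂ => G p.1 p.2) (Icc (-ε) ε ×ˢ K) →
      ∀ t ∈ Icc (-ε) ε, ContinuousOn (G t) K := fun hG t ht =>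
    hG.comp (continuousOn_const.prodMk continuousOn_id) fun z hz => ⟨ht, hz⟩
  have h00 : (0 : ℝ) ∈ Icc (-ε) ε := ⟨by linarith, hε0.le⟩
  have hnhds : Icc (-ε) ε ∈ nhds (0 : ℝ) := Icc_mem_nhds (by linarith) hε0
  obtain ⟨N, hN⟩ := (isCompact_Icc.prod hKc).exists_bound_of_continuousOn hFc'
  have main := (hasDerivAt_integral_of_dominated_loc_of_deriv_le (μ := volume.restrict K)
    (F := F) (F' := F') (x₀ := 0) (bound := fun _ => N) hnhds
    (by filter_upwards [hnhds] with t ht using (slice hFc t ht).aestronglyMeasurable hKm)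
    ((slice hFc 0 h00).integrableOn_compact hKc)
    ((slice hFc' 0 h00).aestronglyMeasurable hKm)
    ((ae_restrict_iff' hKm).2 (.of_forall fun z hz t ht => hN (t, z) ⟨ht, hz⟩))
    (integrableOn_const hKc.measure_lt_top.ne)
    ((ae_restrict_iff' hKm).2 (.of_forall fun z hz t ht => by
      have harg : HasDerivAt (fun t : ℝ => u z + t * φ z) (φ z) t := by
        simpa using ((ofRealCLM.hasDerivAt (x := t)).mul_const (φ z)).const_add (u z)
      have hrd : HasFDerivAt r (fderiv ℝ r (u z + t * φ z)) (u z + t * φ z) :=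
        ((hr.contDiffAt (hT.mem_nhds (hmem t ht z hz))).differentiableAt (by simp)).hasFDerivAt
      have hpoly : HasDerivAt (fun t : ℝ => A z + t * B z + t ^ 2 * C z) (B z + 2 * t * C z) t := by
        have := (((hasDerivAt_id' t).mul_const (B z)).const_add (A z)).fun_add
          ((hasDerivAt_pow 2 t).mul_const (C z))
        simpa using this
      exact (hrd.comp_hasDerivAt t harg).mul hpoly))).2
  have hzero : ∫ z in K, F' 0 z = 0 := by
    refine Eq.trans (integral_congr_ae (.of_forall fun z => ?_))
      (integral_firstVariation_eq_zero hT hU hr hu hm hφ hc hs)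
    simp [F', A, B]
  rwa [hzero] at main

/-! ### Energy and area of a smooth homeomorphism -/

theorem wirtinger_congr {u v : ℂ → ℂ} {z : ℂ} (h : u =ᶠ[nhds z] v) :
    wirtingerZ u z = wirtingerZ v z ∧ wirtingerZbar u z = wirtingerZbar v z := by
  simp [wirtingerZ, wirtingerZbar, h.fderiv_eq]

theorem isOpen_chartDom {S T : Type*} [TopologicalSpace S] [TopologicalSpace T] {g : S → T}
    (hg : Continuous g) (c : OpenPartialHomeomorph S ℂ) (e : OpenPartialHomeomorph T ℂ) :
    IsOpen (chartDom g c e) :=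
  (hg.comp_continuousOn c.continuousOn_symm).isOpen_inter_preimage c.open_target e.open_source

section energy

variable {S T : Type*} [TopologicalSpace S] [TopologicalSpace T] [ChartedSpace ℂ T]
  {𝒜 : Set (OpenPartialHomeomorph S ℂ)}

theorem differentiableOn_transition [IsManifold 𝓘(ℂ) ω T] {e e' : OpenPartialHomeomorph T ℂ}
    (he : e ∈ atlas ℂ T) (he' : e' ∈ atlas ℂ T) :
    DifferentiableOn ℂ (e' ∘ e.symm) (e.symm.trans e').source := by
  have h := (contDiffGroupoid ω 𝓘(ℂ)).compatible he he'
  rw [contDiffGroupoid, mem_groupoid_of_pregroupoid] at h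
  have h1 := h.1
  simp only [contDiffPregroupoid, modelWithCornersSelf_coe,
    modelWithCornersSelf_coe_symm, Function.comp_id, Function.id_comp, range_id, inter_univ,
    preimage_id] at h1
  exact h1.differentiableOn (by simp)

theorem ConformalMetric.isConformalDensity [IsManifold 𝓘(ℂ) ω T] (ρ : ConformalMetric T) :
    IsConformalDensity (atlas ℂ T) fun e z => ENNReal.ofReal (ρ.dens e z) where
  holomorphic _ he _ he' := differentiableOn_transition he he'
  compat e he e' he' z hz := by
    rw [ρ.compat e he e' he' z hz, ENNReal.ofReal_mul]
    exact (ρ.pos e' he' _ (e'.map_source hz.2)).le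

theorem energyDens_chart_change [IsManifold 𝓘(ℂ) ω T] (ρ : ConformalMetric T) {g : S → T}
    (hg : Continuous g) {c : OpenPartialHomeomorph S ℂ} {e e' : OpenPartialHomeomorph T ℂ}
    (he : e ∈ atlas ℂ T) (he' : e' ∈ atlas ℂ T) {z : ℂ} (hz : z ∈ chartDom g c e)
    (hz' : z ∈ chartDom g c e') (hd : DifferentiableAt ℝ (chartMap g c e) z) :
    energyDens (ρ.dens e) (chartMap g c e) z = energyDens (ρ.dens e') (chartMap g c e') z := by
  have hmem : chartMap g c e z ∈ (e.symm.trans e').source := by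
    simp [chartMap, e.map_source hz.2, e.left_inv hz.2, hz'.2]
  have hcongr : chartMap g c e' =ᶠ[nhds z] (e' ∘ e.symm) ∘ chartMap g c e := by
    filter_upwards [(isOpen_chartDom hg c e).mem_nhds hz] with x hx
    simp [chartMap, e.left_inv hx.2]
  have hh := ((differentiableOn_transition he he').differentiableAt
    ((e.symm.trans e').open_source.mem_nhds hmem)).hasDerivAt
  obtain ⟨h1, h2⟩ := wirtinger_congr hcongr
  obtain ⟨h3, h4⟩ := wirtinger_comp_left hd hh
  rw [energyDens, energyDens, h1, h2, h3, h4, ρ.compat e he e' he' _ hmem, norm_mul, norm_mul,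
    show e' (e.symm (chartMap g c e z)) = chartMap g c e' z by simp [chartMap, e.left_inv hz.2]]
  ring

/-- The energy density of a smooth map transforms as a 2-form on the source. -/
theorem isConformalDensity_energy
    (h𝒜 : ∀ c ∈ 𝒜, ∀ c' ∈ 𝒜, DifferentiableOn ℂ (c' ∘ c.symm) (c.symm.trans c').source)
    (ρ : ConformalMetric T) {g : S → T} (hg : Continuous g)
    (hs : ∀ c ∈ 𝒜, ∀ e ∈ atlas ℂ T, ContDiffOn ℝ ∞ (chartMap g c e) (chartDom g c e)) :
    IsConformalDensity 𝒜 fun c z =>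
      let e := chartAt ℂ (g (c.symm z))
      ENNReal.ofReal (energyDens (ρ.dens e) (chartMap g c e) z) where
  holomorphic := h𝒜
  compat c hc c' hc' z hz := by
    have hz1 : z ∈ c.target := hz.1
    have hz2 : c.symm z ∈ c'.source := hz.2
    simp only [c'.left_inv hz2]
    set e := chartAt ℂ (g (c.symm z))
    have he : e ∈ atlas ℂ T := chart_mem_atlas ℂ _
    have hcongr : chartMap g c e =ᶠ[nhds z] chartMap g c' e ∘ (c' ∘ c.symm) := by
      filter_upwards [(c.symm.trans c').open_source.mem_nhds hz] with x hx
      have : c.symm x ∈ c'.source := hx.2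
      simp [chartMap, c'.left_inv this]
    have hdom : (c' ∘ c.symm) z ∈ chartDom g c' e := by
      refine ⟨c'.map_source hz2, ?_⟩
      simp only [Function.comp, c'.left_inv hz2]
      exact mem_chart_source ℂ _
    have hd : DifferentiableAt ℝ (chartMap g c' e) ((c' ∘ c.symm) z) :=
      ((hs c' hc' e he).contDiffAt
        ((isOpen_chartDom hg c' e).mem_nhds hdom)).differentiableAt (by simp)
    have hh := ((h𝒜 c hc c' hc').differentiableAt
      ((c.symm.trans c').open_source.mem_nhds hz)).hasDerivAt
    obtain ⟨h1, h2⟩ := wirtinger_congr hcongr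
    obtain ⟨h3, h4⟩ := wirtinger_comp_right hd hh
    rw [← ENNReal.ofReal_mul' (by positivity), energyDens, energyDens, h1, h2, h3, h4,
      hcongr.eq_of_nhds, norm_mul, norm_mul, RCLike.norm_conj]
    simp only [Function.comp]
    ring_nf

/-- The pull-back of the area form, `ρ(u) ||u_z|² - |u_z̄|²|`. -/
noncomputable def areaDens (r : ℂ → ℝ) (u : ℂ → ℂ) (z : ℂ) : ℝ :=
  r (u z) * |‖wirtingerZ u z‖ ^ 2 - ‖wirtingerZbar u z‖ ^ 2|

theorem lintegral_image_eq_lintegral_areaDens (ρ : ConformalMetric T) (g : S ≃ₜ T)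
    {c : OpenPartialHomeomorph S ℂ} {e : OpenPartialHomeomorph T ℂ}
    (he : e ∈ atlas ℂ T) (hs : ContDiffOn ℝ ∞ (chartMap g c e) (chartDom g c e)) {R : Set S}
    (hc : R ⊆ c.source) (hR : g '' R ⊆ e.source) (hm : MeasurableSet (c '' R)) :
    ∫⁻ w in e '' (g '' R), ENNReal.ofReal (ρ.dens e w) =
      ∫⁻ z in c '' R, ENNReal.ofReal (areaDens (ρ.dens e) (chartMap g c e) z) := by
  have hsub : c '' R ⊆ chartDom g c e := by
    rintro _ ⟨x, hx, rfl⟩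
    exact ⟨c.map_source (hc hx), by rw [c.left_inv (hc hx)]; exact hR (mem_image_of_mem g hx)⟩
  have himg : e '' (g '' R) = chartMap g c e '' (c '' R) := by
    rw [image_image, image_image]
    exact image_congr fun x hx => by simp [chartMap, c.left_inv (hc hx)]
  have hinj : InjOn (chartMap g c e) (c '' R) := fun x hx y hy hxy =>
    c.symm.injOn (hsub hx).1 (hsub hy).1
      (g.injective (e.injOn (hsub hx).2 (hsub hy).2 hxy))
  rw [himg, lintegral_image_eq_lintegral_abs_det_fderiv_mul volume hm
    (fun z hz => (((hs.contDiffAt ((isOpen_chartDom g.continuous c e).mem_nhds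
      (hsub hz))).differentiableAt (by simp)).hasFDerivAt.hasFDerivWithinAt)) hinj]
  refine setLIntegral_congr_fun hm fun z hz => ?_
  rw [areaDens, det_fderiv_eq_wirtinger, mul_comm,
    ENNReal.ofReal_mul (ρ.pos e he (chartMap g c e z) (e.map_source (hsub hz).2)).le]

theorem exists_area_energy_eq_tsum [SecondCountableTopology S] [SecondCountableTopology T]
    [IsManifold 𝓘(ℂ) ω T]
    (h𝒜 : ∀ c ∈ 𝒜, ∀ c' ∈ 𝒜, DifferentiableOn ℂ (c' ∘ c.symm) (c.symm.trans c').source)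
    (hcov : ∀ x : S, ∃ c ∈ 𝒜, x ∈ c.source) (ρ : ConformalMetric T) (g : S ≃ₜ T)
    (hs : ∀ c ∈ 𝒜, ∀ e ∈ atlas ℂ T, ContDiffOn ℝ ∞ (chartMap g c e) (chartDom g c e))
    {c₀ : OpenPartialHomeomorph S ℂ} (hc₀ : c₀ ∈ 𝒜) {e₀ : OpenPartialHomeomorph T ℂ}
    (he₀ : e₀ ∈ atlas ℂ T) :
    ∃ (c : ℕ × ℕ → OpenPartialHomeomorph S ℂ) (e : ℕ × ℕ → OpenPartialHomeomorph T ℂ)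
      (V : ℕ × ℕ → Set ℂ),
      (∀ i, c i ∈ 𝒜 ∧ e i ∈ atlas ℂ T ∧ MeasurableSet (V i) ∧ V i ⊆ chartDom g (c i) (e i)) ∧
      ρ.area = ∑' i, ∫⁻ z in V i,
        ENNReal.ofReal (areaDens (ρ.dens (e i)) (chartMap g (c i) (e i)) z) ∧
      harmonicEnergy 𝒜 ρ g = ∑' i, ∫⁻ z in V i,
        ENNReal.ofReal (energyDens (ρ.dens (e i)) (chartMap g (c i) (e i)) z) ∧
      c 0 = c₀ ∧ e 0 = e₀ ∧ V 0 = chartDom g c₀ e₀ := by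
  obtain ⟨c, P, hc, hP, hPm, hPd, hPu, hc0, hP0⟩ := exists_borel_partition hcov hc₀
  obtain ⟨e, Q, he, hQ, hQm, hQd, hQu, he0, hQ0⟩ := exists_borel_partition (𝒜 := atlas ℂ T)
    (fun y => ⟨chartAt ℂ y, chart_mem_atlas ℂ y, mem_chart_source ℂ y⟩) he₀
  let R : ℕ × ℕ → Set S := fun i => P i.1 ∩ g ⁻¹' Q i.2
  have hRc : ∀ i, R i ⊆ (c i.1).source := fun i => inter_subset_left.trans (hP i.1)
  have hRe : ∀ i, g '' R i ⊆ (e i.2).source := by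
    rintro i _ ⟨x, hx, rfl⟩
    exact hQ i.2 hx.2
  have hRm : ∀ i, MeasurableSet[borel S] (R i) := fun i => by
    borelize S T
    exact (hPm i.1).inter (g.continuous.measurable (hQm i.2))
  have hgRm : ∀ i, MeasurableSet[borel T] (g '' R i) := fun i => by
    have := hRm i
    borelize S T
    exact g.measurableEmbedding.measurableSet_image.2 this
  have hRd : Pairwise (Function.onFun Disjoint R) := by
    intro i j hij
    by_cases h1 : i.1 = j.1
    · have h2 : i.2 ≠ j.2 := fun h2 => hij (Prod.ext h1 h2)
      exact ((hQd h2).preimage g).mono inter_subset_right inter_subset_right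
    · exact (hPd h1).mono inter_subset_left inter_subset_left
  have hRu : ⋃ i, R i = univ := by
    refine eq_univ_iff_forall.2 fun x => ?_
    obtain ⟨i, hi⟩ := mem_iUnion.1 (hPu ▸ mem_univ x : x ∈ ⋃ i, P i)
    obtain ⟨j, hj⟩ := mem_iUnion.1 (hQu ▸ mem_univ (g x) : g x ∈ ⋃ j, Q j)
    exact mem_iUnion.2 ⟨(i, j), hi, hj⟩
  have hVm : ∀ i, MeasurableSet (c i.1 '' R i) := fun i =>
    (measurableSet_image_iff_borel _ (hRc i)).2 (hRm i)
  have hV : ∀ i, c i.1 '' R i ⊆ chartDom g (c i.1) (e i.2) := by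
    rintro i _ ⟨x, hx, rfl⟩
    refine ⟨(c i.1).map_source (hRc i hx), ?_⟩
    rw [(c i.1).left_inv (hRc i hx)]
    exact hRe i (mem_image_of_mem g hx)
  refine ⟨fun i => c i.1, fun i => e i.2, fun i => c i.1 '' R i,
    fun i => ⟨hc _, he _, hVm i, hV i⟩, ?_, ?_, hc0, he0, ?_⟩
  · rw [ConformalMetric.area, ρ.isConformalDensity.surfaceIntegral_eq_tsum (fun i => he i.2) hRe
      hgRm (fun i j hij => (disjoint_image_iff g.injective).2 (hRd hij))
      (by rw [← image_iUnion, hRu, image_univ, g.range_coe])]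
    exact tsum_congr fun i => lintegral_image_eq_lintegral_areaDens ρ g (he i.2)
      (hs _ (hc i.1) _ (he i.2)) (hRc i) (hRe i) (hVm i)
  · rw [harmonicEnergy, (isConformalDensity_energy h𝒜 ρ g.continuous hs).surfaceIntegral_eq_tsum
      (fun i => hc i.1) hRc hRm hRd hRu]
    refine tsum_congr fun i => setLIntegral_congr_fun (hVm i) fun z hz => ?_
    have hz' : z ∈ chartDom g (c i.1) (chartAt ℂ (g ((c i.1).symm z))) :=
      ⟨(hV i hz).1, mem_chart_source ℂ _⟩
    exact congrArg ENNReal.ofReal (energyDens_chart_change ρ g.continuous (chart_mem_atlas ℂ _)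
      (he i.2) hz' (hV i hz) (((hs _ (hc i.1) _ (chart_mem_atlas ℂ _)).contDiffAt
        ((isOpen_chartDom g.continuous _ _).mem_nhds hz')).differentiableAt (by simp)))
  · change c 0 '' (P 0 ∩ g ⁻¹' Q 0) = _
    rw [hc0, hP0, hQ0, c₀.image_source_inter_eq']
    rfl

theorem areaDens_le_energyDens {r : ℂ → ℝ} {u : ℂ → ℂ} {z : ℂ} (h : 0 ≤ r (u z)) :
    areaDens r u z ≤ energyDens r u z := by
  refine mul_le_mul_of_nonneg_left (abs_le.2 ⟨?_, ?_⟩) h <;>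
    nlinarith [sq_nonneg ‖wirtingerZ u z‖, sq_nonneg ‖wirtingerZbar u z‖]

theorem wirtinger_eq_zero_of_areaDens_eq {r : ℂ → ℝ} {u : ℂ → ℂ} {z : ℂ} (h : 0 < r (u z))
    (heq : areaDens r u z = energyDens r u z) : wirtingerZ u z = 0 ∨ wirtingerZbar u z = 0 := by
  have h1 := mul_left_cancel₀ h.ne' heq
  rcases abs_choice (‖wirtingerZ u z‖ ^ 2 - ‖wirtingerZbar u z‖ ^ 2) with h2 | h2
  · right
    have : ‖wirtingerZbar u z‖ ^ 2 = 0 := by linarith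
    simpa using this
  · left
    have : ‖wirtingerZ u z‖ ^ 2 = 0 := by linarith
    simpa using this

theorem continuousOn_energyDens {r : ℂ → ℝ} {u : ℂ → ℂ} {U V : Set ℂ} (hU : IsOpen U)
    (hr : ContinuousOn r V) (hu : ContDiffOn ℝ ∞ u U) (hm : MapsTo u U V) :
    ContinuousOn (energyDens r u) U :=
  (hr.comp hu.continuousOn hm).mul
    (((continuousOn_wirtinger hU hu).1.norm.pow 2).add ((continuousOn_wirtinger hU hu).2.norm.pow 2))

theorem IsConformal.isHarmonicMap {ρ : ConformalMetric T} {g : S → T} (hc : Continuous g)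
    (hg : IsConformal 𝒜 g) : IsHarmonicMap 𝒜 ρ g := fun c hcA e he =>
  ⟨(hg c hcA e he).contDiffOn_real (isOpen_chartDom hc c e),
    fun _ hφ hφc hφs => hasDerivAt_integral_energyDens e.open_target (isOpen_chartDom hc c e) (ρ.smooth e he)
      (hg c hcA e he) (fun _ hz => e.map_source hz.2) hφ hφc hφs⟩

end energy

section homeomorphisms

variable {S T : Type*} [TopologicalSpace S] [TopologicalSpace T] [ChartedSpace ℂ T]
  [SecondCountableTopology S] [SecondCountableTopology T] [IsManifold 𝓘(ℂ) ω T]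
  {𝒜 : Set (OpenPartialHomeomorph S ℂ)}

theorem area_le_harmonicEnergy [Nonempty S]
    (h𝒜 : ∀ c ∈ 𝒜, ∀ c' ∈ 𝒜, DifferentiableOn ℂ (c' ∘ c.symm) (c.symm.trans c').source)
    (hcov : ∀ x : S, ∃ c ∈ 𝒜, x ∈ c.source) (ρ : ConformalMetric T) (g : S ≃ₜ T)
    (hs : ∀ c ∈ 𝒜, ∀ e ∈ atlas ℂ T, ContDiffOn ℝ ∞ (chartMap g c e) (chartDom g c e)) :
    ρ.area ≤ harmonicEnergy 𝒜 ρ g := by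
  obtain ⟨x⟩ := ‹Nonempty S›
  obtain ⟨c₀, hc₀, -⟩ := hcov x
  obtain ⟨c, e, V, hV, ha, hE, -⟩ :=
    exists_area_energy_eq_tsum h𝒜 hcov ρ g hs hc₀ (chart_mem_atlas ℂ (g x))
  rw [ha, hE]
  refine ENNReal.tsum_le_tsum fun i => setLIntegral_mono' (hV i).2.2.1 fun z hz => ?_
  exact ENNReal.ofReal_le_ofReal (areaDens_le_energyDens
    ((ρ.pos _ (hV i).2.1 _ ((e i).map_source ((hV i).2.2.2 hz).2)).le))

theorem harmonicEnergy_eq_area_of_isConformal [Nonempty S]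
    (h𝒜 : ∀ c ∈ 𝒜, ∀ c' ∈ 𝒜, DifferentiableOn ℂ (c' ∘ c.symm) (c.symm.trans c').source)
    (hcov : ∀ x : S, ∃ c ∈ 𝒜, x ∈ c.source) (ρ : ConformalMetric T) (g : S ≃ₜ T)
    (hg : IsConformal 𝒜 g) : harmonicEnergy 𝒜 ρ g = ρ.area := by
  obtain ⟨x⟩ := ‹Nonempty S›
  obtain ⟨c₀, hc₀, -⟩ := hcov x
  obtain ⟨c, e, V, hV, ha, hE, -⟩ := exists_area_energy_eq_tsum h𝒜 hcov ρ g
    (fun c hc e he => (hg c hc e he).contDiffOn_real (isOpen_chartDom g.continuous c e)) hc₀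
    (chart_mem_atlas ℂ (g x))
  rw [ha, hE]
  refine tsum_congr fun i => setLIntegral_congr_fun (hV i).2.2.1 fun z hz => ?_
  have hd := (hg _ (hV i).1 _ (hV i).2.1).differentiableAt
    ((isOpen_chartDom g.continuous _ _).mem_nhds ((hV i).2.2.2 hz))
  simp [energyDens, areaDens, (wirtinger_of_hasDerivAt hd.hasDerivAt).2]

theorem isConformal_of_harmonicEnergy_eq_area
    (h𝒜 : ∀ c ∈ 𝒜, ∀ c' ∈ 𝒜, DifferentiableOn ℂ (c' ∘ c.symm) (c.symm.trans c').source)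
    (hcov : ∀ x : S, ∃ c ∈ 𝒜, x ∈ c.source) (ρ : ConformalMetric T) (g : S ≃ₜ T)
    (hs : ∀ c ∈ 𝒜, ∀ e ∈ atlas ℂ T, ContDiffOn ℝ ∞ (chartMap g c e) (chartDom g c e))
    (hqc : IsQuasiconformal 𝒜 g) (hρ : ρ.area ≠ ⊤) (heq : harmonicEnergy 𝒜 ρ g = ρ.area) :
    IsConformal 𝒜 g := by
  intro c₀ hc₀ e₀ he₀
  obtain ⟨c, e, V, hV, ha, hE, hc, he, hV0⟩ :=
    exists_area_energy_eq_tsum h𝒜 hcov ρ g hs hc₀ he₀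
  have hle : ∀ i, ∀ z ∈ V i,
      ENNReal.ofReal (areaDens (ρ.dens (e i)) (chartMap g (c i) (e i)) z) ≤
        ENNReal.ofReal (energyDens (ρ.dens (e i)) (chartMap g (c i) (e i)) z) := fun i z hz =>
    ENNReal.ofReal_le_ofReal (areaDens_le_energyDens
      ((ρ.pos _ (hV i).2.1 _ ((e i).map_source ((hV i).2.2.2 hz).2)).le))
  have hle' := fun i => setLIntegral_mono' (μ := volume) (hV i).2.2.1 (hle i)
  have hterm : ∫⁻ z in V 0, ENNReal.ofReal (energyDens (ρ.dens (e 0)) (chartMap g (c 0) (e 0)) z) ≤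
      ∫⁻ z in V 0, ENNReal.ofReal (areaDens (ρ.dens (e 0)) (chartMap g (c 0) (e 0)) z) := by
    by_contra! hlt
    refine (ENNReal.tsum_lt_tsum (ha ▸ hρ) hle' hlt).ne ?_
    rw [← ha, ← hE, heq]
  have hfin : ∫⁻ z in V 0, ENNReal.ofReal (areaDens (ρ.dens (e 0)) (chartMap g (c 0) (e 0)) z) ≠
      ⊤ := fun h => hρ (ha.trans (ENNReal.tsum_eq_top_of_eq_top ⟨0, h⟩))
  have hle0 := hle 0
  rw [hc, he, hV0] at hterm hfin hle0
  set u := chartMap g c₀ e₀ with hu_def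
  set U := chartDom g c₀ e₀ with hU_def
  have hU : IsOpen U := isOpen_chartDom g.continuous c₀ e₀
  have hu := hs c₀ hc₀ e₀ he₀
  have hmaps : MapsTo u U e₀.target := fun z hz => e₀.map_source hz.2
  have hmeas : AEMeasurable (fun z => ENNReal.ofReal (energyDens (ρ.dens e₀) u z))
      (volume.restrict U) :=
    ((continuousOn_energyDens hU (ρ.smooth e₀ he₀).continuousOn hu hmaps).aemeasurable
      hU.measurableSet).ennreal_ofReal
  have hae := ae_eq_of_ae_le_of_lintegral_le
    ((ae_restrict_iff' hU.measurableSet).2 (.of_forall hle0)) hfin hmeas hterm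
  obtain ⟨k, -, hk⟩ := hqc
  obtain ⟨p, q, hw, hpq⟩ := hk c₀ hc₀ e₀ he₀
  have hzero : ∀ᵐ z ∂volume.restrict U, wirtingerZbar u z = 0 := by
    filter_upwards [hae, hw.ae_eq hU hu, hpq, ae_restrict_mem hU.measurableSet]
      with z h1 h2 h3 hz
    have hpos := ρ.pos e₀ he₀ _ (hmaps hz)
    rw [ENNReal.ofReal_eq_ofReal_iff (by unfold areaDens; positivity)
      (by unfold energyDens; positivity)] at h1
    rcases wirtinger_eq_zero_of_areaDens_eq hpos h1 with h | h
    · rw [h2.1, h2.2, h, norm_zero, mul_zero] at h3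
      exact norm_le_zero_iff.1 h3
    · exact h
  have hall : EqOn (wirtingerZbar u) (fun _ => 0) U :=
    Measure.eqOn_open_of_ae_eq hzero hU (continuousOn_wirtinger hU hu).2 continuousOn_const
  intro z hz
  exact (differentiableAt_of_wirtingerZbar_eq_zero
    ((hu.contDiffAt (hU.mem_nhds hz)).differentiableAt (by simp)) (hall hz)).differentiableWithinAt

end homeomorphisms

/-- The restriction of a homeomorphism of surfaces with boundary to the interiors. -/
def SurfaceHomeo.innerHomeo {Z₁ Z₂ : Type*} [TopologicalSpace Z₁] [TopologicalSpace Z₂]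
    {S₁ : TopologicalSpace.Opens Z₁} {S₂ : TopologicalSpace.Opens Z₂} (w : SurfaceHomeo S₁ S₂) :
    S₁ ≃ₜ S₂ :=
  w.toHomeomorph.subtype fun x => (w.mem_iff x).symm

theorem lemma3p1 {Z₁ Z₂ : Type*}
    [TopologicalSpace Z₁] [T2Space Z₁] [SecondCountableTopology Z₁]
    [TopologicalSpace Z₂] [T2Space Z₂] [SecondCountableTopology Z₂]
    (S₁ : TopologicalSpace.Opens Z₁) [ConnectedSpace S₁]
    [ChartedSpace ℂ S₁] [IsManifold 𝓘(ℂ) ω S₁]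
    (S₂ : TopologicalSpace.Opens Z₂) [ConnectedSpace S₂]
    [ChartedSpace ℂ S₂] [IsManifold 𝓘(ℂ) ω S₂]
    (ρ : ConformalMetric S₂) (hρ : ρ.area ≠ ⊤)
    (f : SurfaceHomeo S₁ S₂) (hf : IsQuasiconformal (atlas ℂ S₁) f.inner)
    (μ : BeltramiDifferential S₁) (hμ : μ.ConstantModulus)
    (g : InducedStructure μ) (h : IsAdmissible g ρ f) :
    ρ.area ≤ energyBC h ∧
    (energyBC h = ρ.area ↔ ConformallyEquivalent g f) ∧
    (energyBC h = ρ.area → IsConformal g.charts (harmonicRep h).inner) := by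
  have hw : IsHarmonicInClass g ρ f (harmonicRep h) := h.exists.choose_spec
  have hs : ∀ c ∈ g.charts, ∀ e ∈ atlas ℂ S₂, ContDiffOn ℝ ∞
      (chartMap (harmonicRep h).innerHomeo c e) (chartDom (harmonicRep h).innerHomeo c e) :=
    fun c hc e he => (hw.2 c hc e he).1
  have hconf : energyBC h = ρ.area → IsConformal g.charts (harmonicRep h).inner :=
    isConformal_of_harmonicEnergy_eq_area g.holomorphic g.cover ρ (harmonicRep h).innerHomeo hs
      hw.1.1 hρ
  refine ⟨area_le_harmonicEnergy g.holomorphic g.cover ρ (harmonicRep h).innerHomeo hs,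
    ⟨fun heq => ⟨harmonicRep h, hw.1, hconf heq⟩, ?_⟩, hconf⟩
  rintro ⟨φ, hφ, hφc⟩
  have hφw : φ = harmonicRep h :=
    h.unique ⟨hφ, hφc.isHarmonicMap φ.innerHomeo.continuous⟩ hw
  exact harmonicEnergy_eq_area_of_isConformal g.holomorphic g.cover ρ (harmonicRep h).innerHomeo
    (hφw ▸ hφc)
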